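/- **Model.** There are $N$ agents, ranked $1,\dots,N$, and $K\ge N$ arms. In each round $t=1,2,\dots$ every agent $i$ chooses an arm $I^{(i)}(t)$. Agent $i$ is matched in round $t$ if no higher ranked agent (one of $1,\dots,i-1$) chooses the same arm; otherwise it is blocked, which it is told, and its reward is $0$. An agent $i$ matched with arm $k$ receives a Bernoulli reward of mean $\mu_{ik}\in(0,1)$, independent of all other rewards. For each agent $i$ the means $(\mu_{ik})_{k}$ are pairwise distinct. An instance is the collection $\nu=(\mu_{ik})$. Its unique stable matching gives agent $i$ the arm $k_*^{(i)}=\arg\max_{k\notin\{k_*^{(1)},\dots,k_*^{(i-1)}\}}\mu_{ik}$. The instance is *optimally stable* (OSB) if $\mu_{ik}<\mu_{ik_*^{(i)}}$ for all $i$ and all $k\ne k_*^{(i)}$, and its minimum gap is the smallest value of $\mu_{ik_*^{(i)}}-\mu_{ik}$ over all agents $i$ and all arms $k\notin\{k_*^{(1)},\dots,k_*^{(i)}\}$. A policy gives, for each $t$, the (joint) distribution of the arms chosen in round $t+1$ as a function of the choices, rewards and blockings of rounds $1,\dots,t$; this includes all decentralized policies, in which each agent uses its own observations only. The regret of agent $i$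 is $R_T^{(i)}(\nu,\pi)=\sum_{t=1}^T\mathbb E_{\nu,\pi}\big[\mu_{ik_*^{(i)}}-\mu_{iI^{(i)}(t)}\mathbf 1\{i\text{ is matched in round }t\}\big]$. A policy $\pi$ is *uniformly consistent* if $\limsup_{T\to\infty}R_T^{(i)}(\nu,\pi)/T^\alpha\le 0$ for every instance $\nu$ (with $N$ agents and $K$ arms), every agent $i$ and every $\alpha\in(0,1)$. **Statement.** There is a universal constant $c>0$ such that for all $K\ge 2$, all $N\le K$, all $j\in\{1,\dots,N\}$ and all $\Delta\in(0,1/4]$ there is an OSB instance $\nu$ with $N$ agents, $K$ arms, Bernoulli rewards and minimum gap $\Delta$ on which every uniformly consistent policy $\pi$ satisfies, for all sufficiently large $T$ (depending on $\nu$ and $\pi$), $$R_T^{(j)}(\nu,\pi)\;\ge\; c\,\max\Big\{\frac{(j-1)\log T}{\Delta^2},\ \frac{K\log T}{\Delta}\Big\}.$$ -/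

import Mathlib

namespace SerialDictatorship

/-- An instance of the serial-dictatorship bandit with Bernoulli rewards: `N` agents, `K ≥ N` arms,
and for agent `j` and arm `k` the mean `mean j k ∈ (0, 1)` of the Bernoulli reward that `j` gets
when matched with `k`; each agent has pairwise distinct arm means.
Agents are indexed by `Fin N` in the order of their ranks, starting from `0`: `i < j` means that
`i` is ranked higher than `j`, and the agent of rank `r` in `{1, …, N}` has index `r - 1`. -/
structure BernoulliInstance (N K : ℕ) where
  mean : Fin N → Fin K → ℝ
  agents_le_arms : N ≤ K
  mean_pos : ∀ j k, 0 < mean j k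
  mean_lt_one : ∀ j k, mean j k < 1
  mean_injective : ∀ j, Function.Injective (mean j)

namespace BernoulliInstance

variable {N K : ℕ}

/-- `m` matches agents to distinct arms, and there is no blocking pair: if agent `j` strictly
prefers arm `k` to its partner `m j`, then `k` is matched to an agent ranked higher than `j`. -/
def IsStableMatching (ν : BernoulliInstance N K) (m : Fin N → Fin K) : Prop :=
  Function.Injective m ∧ ∀ j k, ν.mean j (m j) < ν.mean j k → ∃ i, i < j ∧ m i = k

theorem existsUnique_isStableMatching (ν : BernoulliInstance N K) :
    ∃! m : Fin N → Fin K, ν.IsStableMatching m := by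
  classical
  have key : ∀ n : ℕ, n ≤ N → ∃ m : Fin N → Fin K,
      (∀ i j : Fin N, i.1 < n → j.1 < n → m i = m j → i = j) ∧
      ∀ j : Fin N, j.1 < n → ∀ k, ν.mean j (m j) < ν.mean j k → ∃ i, i < j ∧ m i = k := by
    intro n
    induction n with
    | zero =>
      intro _
      exact ⟨fun i => Fin.castLE ν.agents_le_arms i, by simp, by simp⟩
    | succ n ih =>
      intro hn
      obtain ⟨m, hm1, hm2⟩ := ih (by omega)
      let a : Fin N := ⟨n, hn⟩
      let used : Finset (Fin K) := (Finset.univ.filter fun i : Fin N => i < a).image m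
      have hcard : used.card < K := by
        calc used.card ≤ (Finset.univ.filter fun i : Fin N => i < a).card := Finset.card_image_le
          _ < (Finset.univ : Finset (Fin N)).card :=
            Finset.card_lt_card (Finset.filter_ssubset.2 ⟨a, by simp, by simp⟩)
          _ = N := by simp
          _ ≤ K := ν.agents_le_arms
      have hne : (usedᶜ).Nonempty := by
        rw [← Finset.card_pos, Finset.card_compl, Fintype.card_fin]
        omega
      obtain ⟨b, hb, hmax⟩ := Finset.exists_max_image usedᶜ (ν.mean a) hne
      have hb' : ∀ i : Fin N, i.1 < n → m i ≠ b := by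
        intro i hi h
        apply Finset.mem_compl.1 hb
        exact Finset.mem_image.2 ⟨i, by simpa [a, Fin.lt_def] using hi, h⟩
      have hupd : ∀ i : Fin N, i.1 < n → Function.update m a b i = m i := by
        intro i hi
        refine Function.update_of_ne ?_ _ _
        rintro rfl
        exact lt_irrefl _ hi
      have hcases : ∀ i : Fin N, i.1 < n + 1 → i.1 < n ∨ i = a := by
        intro i hi
        rcases Nat.lt_succ_iff_lt_or_eq.1 hi with h | h
        · exact Or.inl h
        · exact Or.inr (Fin.ext h)
      refine ⟨Function.update m a b, ?_, ?_⟩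
      · intro i j hi hj hij
        rcases hcases i hi with hi | rfl <;> rcases hcases j hj with hj | rfl
        · rw [hupd i hi, hupd j hj] at hij
          exact hm1 i j hi hj hij
        · rw [hupd i hi, Function.update_self] at hij
          exact absurd hij (hb' i hi)
        · rw [hupd j hj, Function.update_self] at hij
          exact absurd hij.symm (hb' j hj)
        · rfl
      · intro j hj k hk
        rcases hcases j hj with hj | rfl
        · rw [hupd j hj] at hk
          obtain ⟨i, hi, hik⟩ := hm2 j hj k hk
          exact ⟨i, hi, by rw [hupd i (lt_trans hi hj), hik]⟩
        · rw [Function.update_self] at hk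
          have hku : k ∈ used := by
            by_contra hcon
            exact absurd (hmax k (Finset.mem_compl.2 hcon)) (not_le.2 hk)
          obtain ⟨i, hi, hik⟩ := Finset.mem_image.1 hku
          have hi' : i < a := (Finset.mem_filter.1 hi).2
          exact ⟨i, hi', by rw [hupd i hi', hik]⟩
  obtain ⟨m, hm1, hm2⟩ := key N le_rfl
  have hm : ν.IsStableMatching m :=
    ⟨fun i j h => hm1 i j i.2 j.2 h, fun j k h => hm2 j j.2 k h⟩
  refine ⟨m, hm, ?_⟩
  intro m' hm'
  have hagree : ∀ n : ℕ, ∀ j : Fin N, j.1 = n → m' j = m j := by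
    intro n
    induction n using Nat.strong_induction_on with
    | _ n ih =>
      intro j hj
      apply ν.mean_injective j
      apply le_antisymm
      · by_contra hcon
        obtain ⟨i, hi, hik⟩ := hm.2 j (m' j) (not_le.1 hcon)
        rw [← ih i.1 (hj ▸ hi) i rfl] at hik
        exact absurd (hm'.1 hik) hi.ne
      · by_contra hcon
        obtain ⟨i, hi, hik⟩ := hm'.2 j (m j) (not_le.1 hcon)
        rw [ih i.1 (hj ▸ hi) i rfl] at hik
        exact absurd (hm.1 hik) hi.ne
  exact funext fun j => hagree j.1 j rfl

/-- The partner of agent `j` in the unique stable matching. -/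
noncomputable def stableArm (ν : BernoulliInstance N K) : Fin N → Fin K :=
  ν.existsUnique_isStableMatching.choose

theorem isStableMatching_stableArm (ν : BernoulliInstance N K) :
    ν.IsStableMatching ν.stableArm :=
  ν.existsUnique_isStableMatching.choose_spec.1

/-- Optimally stable bandit: the stable partner of each agent is its best arm among all arms. -/
def IsOSB (ν : BernoulliInstance N K) : Prop :=
  ∀ j k, k ≠ ν.stableArm j → ν.mean j k < ν.mean j (ν.stableArm j)

/-- The gap of arm `k` for agent `j`. -/
noncomputable def gap (ν : BernoulliInstance N K) (j : Fin N) (k : Fin K) : ℝ :=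
  ν.mean j (ν.stableArm j) - ν.mean j k

/-- `Δ` is the smallest gap, over all agents `j` and all arms `k` that are not the stable partner
of `j` or of an agent ranked higher than `j`. -/
def IsMinGap (ν : BernoulliInstance N K) (Δ : ℝ) : Prop :=
  IsLeast {δ | ∃ (j : Fin N) (k : Fin K), (∀ i ≤ j, ν.stableArm i ≠ k) ∧ δ = ν.gap j k} Δ

end BernoulliInstance

/-- What happens in one round: the arm chosen by each agent, and the feedback of each agent, which
is `none` if the agent is blocked and otherwise its Bernoulli reward. -/
abbrev Round (N K : ℕ) : Type := (Fin N → Fin K) × (Fin N → Option Bool)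

/-- A policy (with internal randomization): given the first `t` rounds, the joint distribution of
the arms that the agents choose in the next round. Arbitrary coordination is allowed, so this
contains all decentralized policies, in which each agent uses its own past only. -/
abbrev Policy (N K : ℕ) : Type :=
  (t : ℕ) → (Fin t → Round N K) → stdSimplex ℝ (Fin N → Fin K)

/-- Agent `j` is matched (to `a j`) iff no higher ranked agent chooses the same arm. -/
def Matched {N K : ℕ} (a : Fin N → Fin K) (j : Fin N) : Prop :=
  ∀ i < j, a i ≠ a j

/-- Probability of the feedback of an agent that is matched to an arm of mean `p`. -/
def rewardProb (p : ℝ) : Option Bool → ℝ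
  | none => 0
  | some true => p
  | some false => 1 - p

open Classical in
/-- Conditional probability of the feedbacks `x` of all agents when they choose the arms `a`:
matched agents get independent rewards, the other agents are blocked. -/
noncomputable def feedbackProb {N K : ℕ} (ν : BernoulliInstance N K) (a : Fin N → Fin K)
    (x : Fin N → Option Bool) : ℝ :=
  ∏ j, if Matched a j then rewardProb (ν.mean j (a j)) (x j) else if x j = none then 1 else 0

/-- Probability that the first `t` rounds are `h` under the instance `ν` and the policy `π`. -/
noncomputable def historyProb {N K : ℕ} (ν : BernoulliInstance N K) (π : Policy N K) :
    (t : ℕ) → (Fin t → Round N K) → ℝ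
  | 0, _ => 1
  | t + 1, h =>
    historyProb ν π t (fun s => h s.castSucc) *
      ((π t (fun s => h s.castSucc)).1 (h (Fin.last t)).1 *
        feedbackProb ν (h (Fin.last t)).1 (h (Fin.last t)).2)

open Classical in
/-- Expected regret of agent `j` after `T` rounds, against its partner in the stable matching. -/
noncomputable def regret {N K : ℕ} (ν : BernoulliInstance N K) (π : Policy N K) (j : Fin N)
    (T : ℕ) : ℝ :=
  ∑ h : Fin T → Round N K, historyProb ν π T h *
    ∑ t : Fin T, (ν.mean j (ν.stableArm j) -
      if Matched (h t).1 j then ν.mean j ((h t).1 j) else 0)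

/-- Uniformly consistent policy: on every Bernoulli instance with `N` agents and `K` arms, the
regret of each agent has no positive part of the order of a power of `T`. -/
def UniformlyConsistent {N K : ℕ} (π : Policy N K) : Prop :=
  ∀ (ν : BernoulliInstance N K) (j : Fin N) (α : ℝ), 0 < α → α < 1 →
    Filter.limsup (fun T : ℕ => ((regret ν π j T / (T : ℝ) ^ α : ℝ) : EReal)) Filter.atTop ≤ 0

end SerialDictatorship

/-! Let agent `i` like arm `i` best, with mean 1/2, and let its other arms have gaps between `d i`
and `3/2 * d i`. For an arm `k` of index above `i`, raising one mean to `1/2 + d i / 2` makes `k`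
the stable partner of `i`, since no higher ranked agent has `k` as its favourite. A consistent
policy must tell the two instances apart. Blocking reveals nothing about the means, so only rounds
that match `i` to `k` help, and each contributes divergence of order `d i ^ 2`. Hence `i` is matched
to `k` at least `log T / (40 * d i ^ 2)` times (`exp_neg_le_test_error`,
`UniformlyConsistent.eventually_log_le`, `eventually_log_le_matchCount`).

This exploration hurts agent `j` in two ways. Every `i < j` must explore arm `j` and so takes it
away from `j`; with gap 1/4 for `j` and gap scale Δ for the others, this costs order `j * log T / Δ
^ 2`. With all `d i = Δ`, agent `j` must itself explore the arms of index above `j`, at cost Δ per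
round, which gives order `K * log T / Δ` when a constant fraction of the arms lies there. The counts
add up because an arm accepts one agent and an agent holds one arm per round. -/

namespace SerialDictatorship

variable {N K : ℕ}

/-! ### Expectations over histories -/

open Classical in
/-- Probability of the feedback `x` of agent `j` when the agents choose the arms `a`. -/
noncomputable def agentFeedbackProb (ν : BernoulliInstance N K) (a : Fin N → Fin K) (j : Fin N)
    (x : Option Bool) : ℝ :=
  if Matched a j then rewardProb (ν.mean j (a j)) x else if x = none then 1 else 0

theorem feedbackProb_eq_prod (ν : BernoulliInstance N K) (a : Fin N → Fin K)
    (x : Fin N → Option Bool) : feedbackProb ν a x = ∏ j, agentFeedbackProb ν a j (x j) := rfl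

theorem sum_option_bool (f : Option Bool → ℝ) :
    ∑ y, f y = f none + f (some true) + f (some false) := by
  rw [Fintype.sum_option, Fintype.sum_bool, add_assoc]

theorem agentFeedbackProb_nonneg (ν : BernoulliInstance N K) (a : Fin N → Fin K) (j : Fin N)
    (x : Option Bool) : 0 ≤ agentFeedbackProb ν a j x := by
  unfold agentFeedbackProb
  have h0 := ν.mean_pos j (a j)
  have h1 := ν.mean_lt_one j (a j)
  split_ifs
  · rcases x with _ | _ | _ <;> simp [rewardProb] <;> linarith
  · exact zero_le_one
  · exact le_rfl

theorem sum_agentFeedbackProb (ν : BernoulliInstance N K) (a : Fin N → Fin K) (j : Fin N) :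
    ∑ x, agentFeedbackProb ν a j x = 1 := by
  unfold agentFeedbackProb
  rw [sum_option_bool]
  split_ifs <;> simp_all [rewardProb]

theorem feedbackProb_nonneg (ν : BernoulliInstance N K) (a : Fin N → Fin K)
    (x : Fin N → Option Bool) : 0 ≤ feedbackProb ν a x :=
  Finset.prod_nonneg fun j _ => agentFeedbackProb_nonneg ν a j (x j)

/-- The feedback of agent `i` is distributed according to `agentFeedbackProb`. -/
theorem sum_feedbackProb_mul (ν : BernoulliInstance N K) (a : Fin N → Fin K) (i : Fin N)
    (f : Option Bool → ℝ) :
    ∑ x, feedbackProb ν a x * f (x i) = ∑ y, agentFeedbackProb ν a i y * f y := by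
  -- Absorbing `f` into the `i`-th factor lets the sum factorise over agents; all other factors sum
  -- to 1.
  have h1 : ∀ x : Fin N → Option Bool, feedbackProb ν a x * f (x i) =
      ∏ j, agentFeedbackProb ν a j (x j) * (if j = i then f (x j) else 1) := by
    intro x
    rw [feedbackProb_eq_prod, Finset.prod_mul_distrib, Finset.prod_ite_eq' Finset.univ i]
    simp
  simp_rw [h1]
  rw [← Fintype.prod_sum (fun j y => agentFeedbackProb ν a j y * (if j = i then f y else 1)),
    Finset.prod_eq_single i]
  · simp
  · intro j _ hj
    simp only [hj, if_false, mul_one]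
    exact sum_agentFeedbackProb ν a j
  · simp

theorem sum_feedbackProb (ν : BernoulliInstance N K) (a : Fin N → Fin K) :
    ∑ x, feedbackProb ν a x = 1 := by
  simp_rw [feedbackProb_eq_prod, ← Fintype.prod_sum, sum_agentFeedbackProb]
  exact Finset.prod_const_one

theorem historyProb_nonneg (ν : BernoulliInstance N K) (π : Policy N K) (T : ℕ)
    (h : Fin T → Round N K) : 0 ≤ historyProb ν π T h := by
  induction T with
  | zero => exact zero_le_one
  | succ T ih =>
    exact mul_nonneg (ih _) (mul_nonneg ((π T _).2.1 _) (feedbackProb_nonneg _ _ _))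

/-- Expectation of `f` over the histories of length `T`. -/
noncomputable def expectation (ν : BernoulliInstance N K) (π : Policy N K) (T : ℕ)
    (f : (Fin T → Round N K) → ℝ) : ℝ :=
  ∑ h, historyProb ν π T h * f h

theorem expectation_add (ν : BernoulliInstance N K) (π : Policy N K) (T : ℕ)
    (f g : (Fin T → Round N K) → ℝ) :
    expectation ν π T (fun h => f h + g h) = expectation ν π T f + expectation ν π T g := by
  simp [expectation, mul_add, Finset.sum_add_distrib]

theorem expectation_const_mul (ν : BernoulliInstance N K) (π : Policy N K) (T : ℕ) (c : ℝ)
    (f : (Fin T → Round N K) → ℝ) :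
    expectation ν π T (fun h => c * f h) = c * expectation ν π T f := by
  simp only [expectation, Finset.mul_sum]
  exact Finset.sum_congr rfl fun h _ => by ring

theorem expectation_sum {ι : Type*} (s : Finset ι) (ν : BernoulliInstance N K) (π : Policy N K)
    (T : ℕ) (f : ι → (Fin T → Round N K) → ℝ) :
    expectation ν π T (fun h => ∑ i ∈ s, f i h) = ∑ i ∈ s, expectation ν π T (f i) := by
  simp only [expectation, Finset.mul_sum]
  exact Finset.sum_comm

theorem expectation_mono (ν : BernoulliInstance N K) (π : Policy N K) (T : ℕ)
    {f g : (Fin T → Round N K) → ℝ} (h : ∀ x, f x ≤ g x) :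
    expectation ν π T f ≤ expectation ν π T g :=
  Finset.sum_le_sum fun x _ => mul_le_mul_of_nonneg_left (h x) (historyProb_nonneg ν π T x)

/-- The tower rule: conditioning on all rounds but the last. -/
theorem expectation_succ (ν : BernoulliInstance N K) (π : Policy N K) (T : ℕ)
    (f : (Fin (T + 1) → Round N K) → ℝ) :
    expectation ν π (T + 1) f = expectation ν π T (fun h =>
      ∑ a, (π T h).1 a * ∑ x, feedbackProb ν a x * f (Fin.snoc h (a, x))) := by
  unfold expectation
  rw [← (Fin.snocEquiv fun _ : Fin (T + 1) => Round N K).sum_comp, Fintype.sum_prod_type_right]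
  refine Finset.sum_congr rfl fun h _ => ?_
  rw [Fintype.sum_prod_type, Finset.mul_sum]
  refine Finset.sum_congr rfl fun a _ => ?_
  rw [Finset.mul_sum, Finset.mul_sum]
  refine Finset.sum_congr rfl fun x _ => ?_
  simp only [Fin.snocEquiv, Equiv.coe_fn_mk, historyProb, Fin.snoc_castSucc, Fin.snoc_last]
  ring

theorem expectation_const (ν : BernoulliInstance N K) (π : Policy N K) (T : ℕ) (c : ℝ) :
    expectation ν π T (fun _ => c) = c := by
  induction T with
  | zero => simp [expectation, historyProb]
  | succ T ih =>
    rw [expectation_succ]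
    simp_rw [← Finset.sum_mul, sum_feedbackProb, one_mul]
    simp_rw [← Finset.sum_mul, (π T _).2.2, one_mul]
    exact ih

/-- Additive functionals whose increments have, conditionally on the choices of the round, ordered
means have ordered means. -/
theorem expectation_sum_rounds_le (ν : BernoulliInstance N K) (π : Policy N K) (T : ℕ)
    (f g : Round N K → ℝ)
    (hfg : ∀ a, ∑ x, feedbackProb ν a x * f (a, x) ≤ ∑ x, feedbackProb ν a x * g (a, x)) :
    expectation ν π T (fun h => ∑ t, f (h t)) ≤ expectation ν π T (fun h => ∑ t, g (h t)) := by
  induction T with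
  | zero => simp
  | succ T ih =>
    have split : ∀ f : Round N K → ℝ, expectation ν π (T + 1) (fun h => ∑ t, f (h t)) =
        expectation ν π T (fun h => ∑ t, f (h t)) +
          expectation ν π T (fun h => ∑ a, (π T h).1 a * ∑ x, feedbackProb ν a x * f (a, x)) := by
      intro f
      rw [expectation_succ, ← expectation_add]
      congr 1
      funext h
      simp_rw [Fin.sum_univ_castSucc, Fin.snoc_castSucc, Fin.snoc_last, mul_add,
        Finset.sum_add_distrib, ← Finset.sum_mul, sum_feedbackProb, one_mul, mul_add,
        Finset.sum_add_distrib, ← Finset.sum_mul, (π T _).2.2, one_mul]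
    rw [split f, split g]
    refine add_le_add ih (expectation_mono ν π T fun h => ?_)
    exact Finset.sum_le_sum fun a _ => mul_le_mul_of_nonneg_left (hfg a) ((π T h).2.1 a)

/-! ### Change of measure -/

/-- Log-likelihood ratio of a feedback under the means `p` and `q`. -/
noncomputable def logLikelihoodRatio (p q : ℝ) : Option Bool → ℝ
  | none => 0
  | some true => Real.log (p / q)
  | some false => Real.log ((1 - p) / (1 - q))

/-- On `none` both sides vanish, so the value of the log-likelihood ratio there is immaterial. -/
theorem rewardProb_eq_mul_exp {p q : ℝ} (hp0 : 0 < p) (hp1 : p < 1) (hq0 : 0 < q) (hq1 : q < 1)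
    (y : Option Bool) :
    rewardProb q y = rewardProb p y * Real.exp (-logLikelihoodRatio p q y) := by
  have hp : 0 < 1 - p := by linarith
  have hq : 0 < 1 - q := by linarith
  rcases y with _ | _ | _
  · simp [rewardProb]
  · simp only [rewardProb, logLikelihoodRatio]
    rw [Real.exp_neg, Real.exp_log (div_pos hp hq)]
    field_simp
  · simp only [rewardProb, logLikelihoodRatio]
    rw [Real.exp_neg, Real.exp_log (div_pos hp0 hq0)]
    field_simp

/-- Kullback–Leibler divergence is at most the χ² divergence, by `log x ≤ x - 1`. -/
theorem sum_rewardProb_mul_logLikelihoodRatio_le {p q : ℝ} (hp0 : 0 < p) (hp1 : p < 1)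
    (hq0 : 0 < q) (hq1 : q < 1) :
    ∑ y, rewardProb p y * logLikelihoodRatio p q y ≤ (p - q) ^ 2 / (q * (1 - q)) := by
  have hp : 0 < 1 - p := by linarith
  have hq : 0 < 1 - q := by linarith
  rw [sum_option_bool]
  simp only [rewardProb, logLikelihoodRatio]
  have h1 := mul_le_mul_of_nonneg_left (Real.log_le_sub_one_of_pos (div_pos hp0 hq0)) hp0.le
  have h2 := mul_le_mul_of_nonneg_left (Real.log_le_sub_one_of_pos (div_pos hp hq)) hp.le
  have h3 : p * (p / q - 1) + (1 - p) * ((1 - p) / (1 - q) - 1) =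
      (p - q) ^ 2 / (q * (1 - q)) := by
    field_simp
    ring
  linarith

open Classical in
/-- Indicator that agent `i` is matched to arm `k`. -/
noncomputable def matchedTo (i : Fin N) (k : Fin K) (a : Fin N → Fin K) : ℝ :=
  if Matched a i ∧ a i = k then 1 else 0

theorem matchedTo_nonneg (i : Fin N) (k : Fin K) (a : Fin N → Fin K) : 0 ≤ matchedTo i k a := by
  unfold matchedTo
  split_ifs <;> norm_num

theorem matchedTo_le_one (i : Fin N) (k : Fin K) (a : Fin N → Fin K) : matchedTo i k a ≤ 1 := by
  unfold matchedTo
  split_ifs <;> norm_num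

/-- Number of rounds in which agent `i` is matched to arm `k`. -/
noncomputable def matchCount (i : Fin N) (k : Fin K) {T : ℕ} (h : Fin T → Round N K) : ℝ :=
  ∑ t, matchedTo i k (h t).1

theorem matchCount_nonneg (i : Fin N) (k : Fin K) {T : ℕ} (h : Fin T → Round N K) :
    0 ≤ matchCount i k h :=
  Finset.sum_nonneg fun _ _ => matchedTo_nonneg _ _ _

theorem matchCount_le (i : Fin N) (k : Fin K) {T : ℕ} (h : Fin T → Round N K) :
    matchCount i k h ≤ T :=
  (Finset.sum_le_sum fun t _ => matchedTo_le_one i k (h t).1).trans (by simp)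

/-- The log-likelihood ratio contributed by a round when the means differ at most for the agent `i`
and the arm `k`. -/
noncomputable def roundLogLikelihoodRatio (p q : ℝ) (i : Fin N) (k : Fin K) (r : Round N K) : ℝ :=
  matchedTo i k r.1 * logLikelihoodRatio p q (r.2 i)

variable {ν ν' : BernoulliInstance N K} {i : Fin N} {k : Fin K}

/-- Feedbacks are independent across agents and blocking depends on the choices alone, so only the
factor of `i` can change, and only when `i` is matched to `k`. -/
theorem feedbackProb_eq_mul_exp
    (hne : ∀ i' k', ¬(i' = i ∧ k' = k) → ν'.mean i' k' = ν.mean i' k')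
    (a : Fin N → Fin K) (x : Fin N → Option Bool) :
    feedbackProb ν' a x = feedbackProb ν a x *
      Real.exp (-roundLogLikelihoodRatio (ν.mean i k) (ν'.mean i k) i k (a, x)) := by
  have h1 : Real.exp (-roundLogLikelihoodRatio (ν.mean i k) (ν'.mean i k) i k (a, x)) =
      ∏ j, if j = i then
        Real.exp (-roundLogLikelihoodRatio (ν.mean i k) (ν'.mean i k) i k (a, x)) else 1 := by
    rw [Finset.prod_ite_eq' Finset.univ i]
    simp
  rw [h1, feedbackProb_eq_prod, feedbackProb_eq_prod, ← Finset.prod_mul_distrib]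
  refine Finset.prod_congr rfl fun j _ => ?_
  unfold agentFeedbackProb roundLogLikelihoodRatio matchedTo
  by_cases hj : j = i
  · subst hj
    by_cases hm : Matched a j
    · by_cases hk : a j = k
      · subst hk
        simpa [hm] using rewardProb_eq_mul_exp (ν.mean_pos _ _) (ν.mean_lt_one _ _)
          (ν'.mean_pos _ _) (ν'.mean_lt_one _ _) (x j)
      · simp [hm, hk, hne j (a j) (fun h => hk h.2)]
    · simp [hm]
  · simp [hj, hne j (a j) (fun h => hj h.1)]

/-- The policy's own factors are the same under both instances and cancel from the likelihood ratio.
-/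
theorem historyProb_eq_mul_exp
    (hne : ∀ i' k', ¬(i' = i ∧ k' = k) → ν'.mean i' k' = ν.mean i' k')
    (π : Policy N K) (T : ℕ) (h : Fin T → Round N K) :
    historyProb ν' π T h = historyProb ν π T h *
      Real.exp (-∑ t, roundLogLikelihoodRatio (ν.mean i k) (ν'.mean i k) i k (h t)) := by
  induction T with
  | zero => simp [historyProb]
  | succ T ih =>
    rw [historyProb, historyProb, ih, Fin.sum_univ_castSucc, neg_add, Real.exp_add,
      feedbackProb_eq_mul_exp hne]
    ring

/-- Divergence decomposition: a round is informative only if `i` is matched to `k`, and then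
contributes at most the χ² bound. -/
theorem expectation_roundLogLikelihoodRatio_le (π : Policy N K) (T : ℕ) {q : ℝ} (hq0 : 0 < q)
    (hq1 : q < 1) :
    expectation ν π T (fun h => ∑ t, roundLogLikelihoodRatio (ν.mean i k) q i k (h t)) ≤
      (ν.mean i k - q) ^ 2 / (q * (1 - q)) * expectation ν π T (matchCount i k) := by
  have h1 : expectation ν π T (fun h => ∑ t, roundLogLikelihoodRatio (ν.mean i k) q i k (h t)) ≤
      expectation ν π T (fun h => ∑ t,
        (fun r : Round N K => (ν.mean i k - q) ^ 2 / (q * (1 - q)) * matchedTo i k r.1) (h t)) := by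
    refine expectation_sum_rounds_le ν π T (roundLogLikelihoodRatio (ν.mean i k) q i k)
      (fun r => (ν.mean i k - q) ^ 2 / (q * (1 - q)) * matchedTo i k r.1) fun a => ?_
    simp only [roundLogLikelihoodRatio]
    rw [← Finset.sum_mul, sum_feedbackProb, one_mul]
    rw [sum_feedbackProb_mul ν a i
      (fun y => matchedTo i k a * logLikelihoodRatio (ν.mean i k) q y)]
    by_cases hm : Matched a i ∧ a i = k
    · obtain ⟨hm, rfl⟩ := hm
      simpa [matchedTo, agentFeedbackProb, hm] using
        sum_rewardProb_mul_logLikelihoodRatio_le (ν.mean_pos _ _) (ν.mean_lt_one _ _) hq0 hq1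
    · simp [matchedTo, hm]
  refine h1.trans_eq ?_
  rw [← expectation_const_mul]
  simp only [matchCount, Finset.mul_sum]

/-- A test `φ` between two measures, the second of which has density `exp (-L)`, errs with total
probability at least `exp (-𝔼 L) / 2` (Bretagnolle–Huber inequality). -/
theorem exp_neg_le_test_error (π : Policy N K) (T : ℕ) (L φ : (Fin T → Round N K) → ℝ)
    (hL : ∀ h, historyProb ν' π T h = historyProb ν π T h * Real.exp (-L h))
    (hφ0 : ∀ h, 0 ≤ φ h) (hφ1 : ∀ h, φ h ≤ 1) :
    Real.exp (-expectation ν π T L) / 2 ≤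
      expectation ν π T φ + expectation ν' π T (fun h => 1 - φ h) := by
  set m := expectation ν π T L with hm
  have hchange : ∀ f, expectation ν' π T f = expectation ν π T (fun h => Real.exp (-L h) * f h) := by
    intro f
    exact Finset.sum_congr rfl fun h _ => by rw [hL h, mul_assoc]
  have htotal : expectation ν π T (fun h => Real.exp (-L h)) = 1 := by
    simpa [expectation_const] using (hchange fun _ => 1).symm
  rw [hchange, ← expectation_add]
  -- Cauchy–Schwarz for `√(min · max)` is linearised pointwise by AM-GM with weight `s`; this `s`
  -- optimises the resulting bound.
  set s := 2 * Real.exp (m / 2) with hs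
  have hspos : 0 < s := by positivity
  have hpoint : ∀ h, Real.exp (-m / 2) * (1 + m / 2) + (-Real.exp (-m / 2) / 2) * L h ≤
      s / 2 * (φ h + Real.exp (-L h) * (1 - φ h)) + 1 / (2 * s) * (1 + Real.exp (-L h)) := by
    intro h
    -- The tangent line of `exp` at the mean `m` of `L` replaces Jensen's inequality.
    have htangent : Real.exp (-m / 2) * (1 + (m - L h) / 2) ≤ Real.exp (-L h / 2) := by
      have h2 : Real.exp (-L h / 2) = Real.exp (-m / 2) * Real.exp ((m - L h) / 2) := by
        rw [← Real.exp_add]; ring_nf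
      rw [h2]
      have := Real.add_one_le_exp ((m - L h) / 2)
      exact mul_le_mul_of_nonneg_left (by linarith) (Real.exp_pos _).le
    have hsq : Real.exp (-L h) = Real.exp (-L h / 2) ^ 2 := by
      rw [← Real.exp_nat_mul]; ring_nf
    rw [hsq]
    set u := Real.exp (-L h / 2)
    have hu : 0 < u := Real.exp_pos _
    have hamgm : u ≤ s / 2 * min 1 (u ^ 2) + 1 / (2 * s) * (1 + u ^ 2) := by
      have e : 1 / (2 * s) = s⁻¹ / 2 := by field_simp
      have es : s * s⁻¹ = 1 := mul_inv_cancel₀ hspos.ne'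
      have hsi : 0 < s⁻¹ := inv_pos.2 hspos
      have key : ∀ v : ℝ, v ≤ s / 2 * v ^ 2 + s⁻¹ / 2 := fun v => by
        have : s / 2 * v ^ 2 + s⁻¹ / 2 - v = s⁻¹ / 2 * (s * v - 1) ^ 2 := by
          linear_combination (v - s / 2 * v ^ 2) * es
        nlinarith [mul_nonneg (half_pos hsi).le (sq_nonneg (s * v - 1))]
      have key' : u ≤ s / 2 + s⁻¹ / 2 * u ^ 2 := by
        have : s / 2 + s⁻¹ / 2 * u ^ 2 - u = s⁻¹ / 2 * (s - u) ^ 2 := by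
          linear_combination (u - s / 2) * es
        nlinarith [mul_nonneg (half_pos hsi).le (sq_nonneg (s - u))]
      rw [e]
      rcases le_total 1 (u ^ 2) with h1 | h1
      · rw [min_eq_left h1]; linarith
      · rw [min_eq_right h1]
        nlinarith [key u, mul_pos hsi (pow_pos hu 2)]
    have hmin : min 1 (u ^ 2) ≤ φ h + u ^ 2 * (1 - φ h) := by
      have h1 := mul_le_mul_of_nonneg_left (min_le_left 1 (u ^ 2)) (hφ0 h)
      have h2 := mul_le_mul_of_nonneg_left (min_le_right 1 (u ^ 2)) (sub_nonneg.2 (hφ1 h))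
      linarith
    have h3 := mul_le_mul_of_nonneg_left hmin (half_pos hspos).le
    linarith
  have hint := expectation_mono ν π T hpoint
  simp only [expectation_add, expectation_const_mul, expectation_const] at hint
  rw [htotal, ← hm, ← expectation_add] at hint
  have e1 : Real.exp (m / 2) * Real.exp (-m / 2) = 1 := by
    rw [← Real.exp_add]; ring_nf; exact Real.exp_zero
  have e2 : Real.exp (-m / 2) * Real.exp (-m / 2) = Real.exp (-m) := by
    rw [← Real.exp_add]; ring_nf
  have e3 : 1 / (2 * s) = Real.exp (-m / 2) / 4 := by
    rw [hs, one_div, inv_eq_iff_eq_inv, inv_div, eq_div_iff (Real.exp_pos _).ne']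
    linear_combination 4 * e1
  rw [e3, hs] at hint
  have h4 := mul_le_mul_of_nonneg_left hint (Real.exp_pos (-m / 2)).le
  rw [← e2]
  linear_combination h4 + expectation ν π T (fun h => φ h + Real.exp (-L h) * (1 - φ h)) * e1

/-! ### Regret and consistency -/

open Classical in
/-- Regret of agent `j` in a round in which the arms `a` are chosen. -/
noncomputable def roundRegret (ν : BernoulliInstance N K) (j : Fin N) (a : Fin N → Fin K) : ℝ :=
  ν.mean j (ν.stableArm j) - if Matched a j then ν.mean j (a j) else 0

theorem regret_eq_expectation (ν : BernoulliInstance N K) (π : Policy N K) (j : Fin N) (T : ℕ) :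
    regret ν π j T = expectation ν π T (fun h => ∑ t, roundRegret ν j (h t).1) := rfl

/-- If the stable partner of agent `j` is better by `g` than all other arms, then each round in
which `j` is not matched to it costs `g`. -/
theorem mul_one_sub_matchedTo_le_roundRegret {j : Fin N} {g : ℝ}
    (hg : g ≤ ν.mean j (ν.stableArm j))
    (hgap : ∀ l, l ≠ ν.stableArm j → ν.mean j l + g ≤ ν.mean j (ν.stableArm j))
    (a : Fin N → Fin K) :
    g * (1 - matchedTo j (ν.stableArm j) a) ≤ roundRegret ν j a := by
  unfold roundRegret matchedTo
  by_cases hm : Matched a j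
  · by_cases ha : a j = ν.stableArm j
    · simp [hm, ha]
    · have := hgap _ ha
      simp only [hm, ha, and_false, if_true, if_false]
      linarith
  · simp [hm, hg]

/-- Any count `c` of rounds lost to `j` bounds its regret from below. The hypothesis `hg` covers
blocked rounds, where the whole mean is lost. -/
theorem le_regret_of_count {j : Fin N} {g : ℝ} (hg0 : 0 ≤ g)
    (hg : g ≤ ν.mean j (ν.stableArm j))
    (hgap : ∀ l, l ≠ ν.stableArm j → ν.mean j l + g ≤ ν.mean j (ν.stableArm j))
    (π : Policy N K) (T : ℕ) (c : (Fin N → Fin K) → ℝ)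
    (hc : ∀ a, c a ≤ 1 - matchedTo j (ν.stableArm j) a) :
    g * expectation ν π T (fun h => ∑ t, c (h t).1) ≤ regret ν π j T := by
  rw [regret_eq_expectation, ← expectation_const_mul]
  refine expectation_mono ν π T fun h => ?_
  rw [Finset.mul_sum]
  refine Finset.sum_le_sum fun t _ => ?_
  exact (mul_le_mul_of_nonneg_left (hc _) hg0).trans
    (mul_one_sub_matchedTo_le_roundRegret hg hgap _)

theorem UniformlyConsistent.eventually_regret_le {π : Policy N K} (hπ : UniformlyConsistent π)
    (ν : BernoulliInstance N K) (j : Fin N) {α : ℝ} (h0 : 0 < α) (h1 : α < 1) :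
    ∀ᶠ T : ℕ in Filter.atTop, regret ν π j T ≤ (T : ℝ) ^ α := by
  have hlt := (hπ ν j α h0 h1).trans_lt (show (0 : EReal) < ((1 : ℝ) : EReal) by norm_num)
  filter_upwards [Filter.eventually_lt_of_limsup_lt hlt, Filter.eventually_gt_atTop 0] with T hT hT0
  have hpos : (0 : ℝ) < (T : ℝ) ^ α := Real.rpow_pos_of_pos (by exact_mod_cast hT0) _
  have := EReal.coe_lt_coe_iff.1 hT
  rw [div_lt_one hpos] at this
  exact this.le

/-- If agent `i` has a strictly best stable partner other than `k` under `ν`, and raising its mean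
for `k` makes `k` its strictly best stable partner, then every uniformly consistent policy matches
`i` to `k` logarithmically often under `ν`. -/
theorem UniformlyConsistent.eventually_log_le {π : Policy N K} (hπ : UniformlyConsistent π)
    (hne : ∀ i' k', ¬(i' = i ∧ k' = k) → ν'.mean i' k' = ν.mean i' k')
    {g : ℝ} (hg0 : 0 < g)
    (hk : k ≠ ν.stableArm i) (hg : g ≤ ν.mean i (ν.stableArm i))
    (hgap : ∀ l, l ≠ ν.stableArm i → ν.mean i l + g ≤ ν.mean i (ν.stableArm i))
    (hk' : ν'.stableArm i = k) (hg' : g ≤ ν'.mean i k)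
    (hgap' : ∀ l, l ≠ k → ν'.mean i l + g ≤ ν'.mean i k) :
    ∀ᶠ T : ℕ in Filter.atTop, Real.log T / 2 ≤
      (ν.mean i k - ν'.mean i k) ^ 2 / (ν'.mean i k * (1 - ν'.mean i k)) *
        expectation ν π T (matchCount i k) := by
  have hlim : ∀ᶠ T : ℕ in Filter.atTop, 4 / g ≤ (T : ℝ) ^ (1 / 4 : ℝ) :=
    ((tendsto_rpow_atTop (by norm_num : (0 : ℝ) < 1 / 4)).comp
      tendsto_natCast_atTop_atTop).eventually_ge_atTop _
  filter_upwards [hlim, hπ.eventually_regret_le ν i (α := 1 / 4) (by norm_num) (by norm_num),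
    hπ.eventually_regret_le ν' i (α := 1 / 4) (by norm_num) (by norm_num),
    Filter.eventually_gt_atTop 0] with T hT hR hR' hT0
  have hTpos : (0 : ℝ) < T := by exact_mod_cast hT0
  refine le_trans ?_ (expectation_roundLogLikelihoodRatio_le (ν := ν) (i := i) (k := k) π T
    (ν'.mean_pos i k) (ν'.mean_lt_one i k))
  -- The fraction of rounds matching `i` to `k` is itself a randomized test, so no threshold or
  -- Markov inequality is needed.
  have hBH := exp_neg_le_test_error π T _ (fun h => (T : ℝ)⁻¹ * matchCount i k h)
    (historyProb_eq_mul_exp hne π T)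
    (fun h => mul_nonneg (inv_nonneg.2 hTpos.le) (matchCount_nonneg _ _ _))
    (fun h => by
      rw [inv_mul_le_iff₀ hTpos, mul_one]
      exact matchCount_le _ _ _)
  set m := expectation ν π T
    (fun h => ∑ t, roundLogLikelihoodRatio (ν.mean i k) (ν'.mean i k) i k (h t))
  have hlow : g * expectation ν π T (matchCount i k) ≤ regret ν π i T := by
    refine le_regret_of_count hg0.le hg hgap π T (matchedTo i k) fun a => ?_
    unfold matchedTo
    by_cases h1 : Matched a i ∧ a i = k
    · simp [h1, hk]
    · split_ifs <;> norm_num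
  have hlow' : g * expectation ν' π T (fun h => ∑ t : Fin T, (1 - matchedTo i k (h t).1)) ≤
      regret ν' π i T := by
    refine le_regret_of_count hg0.le (by rw [hk']; exact hg') (by rw [hk']; exact hgap') π T
      (fun a => 1 - matchedTo i k a) fun a => ?_
    rw [hk']
  have hcount : expectation ν' π T (fun h => 1 - (T : ℝ)⁻¹ * matchCount i k h) =
      (T : ℝ)⁻¹ * expectation ν' π T (fun h => ∑ t : Fin T, (1 - matchedTo i k (h t).1)) := by
    rw [← expectation_const_mul]
    congr 1
    funext h
    rw [Finset.sum_sub_distrib]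
    simp only [matchCount, Finset.sum_const, Finset.card_univ, Fintype.card_fin, nsmul_eq_mul,
      mul_one]
    field_simp
  rw [expectation_const_mul, hcount, ← mul_add] at hBH
  set A := expectation ν π T (matchCount i k)
  set B := expectation ν' π T (fun h => ∑ t : Fin T, (1 - matchedTo i k (h t).1))
  set w := (T : ℝ) ^ (1 / 4 : ℝ) with hw
  have hwpos : 0 < w := Real.rpow_pos_of_pos hTpos _
  have hw4 : (T : ℝ) = w ^ 4 := by
    rw [hw, ← Real.rpow_natCast, ← Real.rpow_mul hTpos.le]
    norm_num
  -- The two regrets total at most `2 * w`, and `4 ≤ w * g` trades the factor `1 / g` for another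
  -- `w`.
  have hsum : A + B ≤ w ^ 2 / 2 := by
    have h4 : 4 ≤ w * g := (div_le_iff₀ hg0).1 hT
    have h5 : g * (A + B) ≤ g * (w ^ 2 / 2) := by nlinarith
    exact le_of_mul_le_mul_left h5 hg0
  have hexp : Real.exp (-m) ≤ (w ^ 2)⁻¹ := by
    have h6 : (T : ℝ)⁻¹ * (A + B) ≤ (T : ℝ)⁻¹ * (w ^ 2 / 2) :=
      mul_le_mul_of_nonneg_left hsum (inv_nonneg.2 hTpos.le)
    have h7 : (T : ℝ)⁻¹ * (w ^ 2 / 2) = (w ^ 2)⁻¹ / 2 := by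
      rw [hw4]; field_simp
    linarith
  have hlog := Real.log_le_log (Real.exp_pos _) hexp
  rw [Real.log_exp, Real.log_inv, Real.log_pow] at hlog
  rw [hw4, Real.log_pow]
  push_cast at hlog ⊢
  linarith

/-! ### The hard instances -/

/-- If the agents up to rank `i` have distinct strictly best arms, these are their stable partners. -/
theorem BernoulliInstance.stableArm_eq_of_best (ν : BernoulliInstance N K) (b : Fin N → Fin K)
    (i : Fin N) (hinj : ∀ i₁ i₂, i₁ < i₂ → i₂ ≤ i → b i₁ ≠ b i₂)
    (hbest : ∀ i' ≤ i, ∀ l, l ≠ b i' → ν.mean i' l < ν.mean i' (b i')) :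
    ν.stableArm i = b i := by
  induction i using WellFoundedLT.induction with
  | _ i ih =>
    by_contra hcon
    -- By stability a higher ranked agent would hold `b i`, but by induction it holds its own
    -- favourite.
    obtain ⟨i', hi', he⟩ := ν.isStableMatching_stableArm.2 i (b i) (hbest i le_rfl _ hcon)
    rw [ih i' hi' (fun i₁ i₂ h1 h2 => hinj i₁ i₂ h1 (h2.trans hi'.le))
      (fun i'' h => hbest i'' (h.trans hi'.le))] at he
    exact hinj i' i hi' le_rfl he

/-- The instance in which one mean is replaced by a number exceeding all means of its agent. -/
def BernoulliInstance.raise (ν : BernoulliInstance N K) (i : Fin N) (k : Fin K) (q : ℝ)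
    (hq : ∀ l, ν.mean i l < q) (hq1 : q < 1) : BernoulliInstance N K where
  mean := Function.update ν.mean i (Function.update (ν.mean i) k q)
  agents_le_arms := ν.agents_le_arms
  mean_pos := by
    intro i' l
    by_cases hi : i' = i
    · subst hi
      by_cases hl : l = k
      · subst hl
        simpa using (ν.mean_pos i' l).trans (hq l)
      · simpa [hl] using ν.mean_pos i' l
    · simpa [hi] using ν.mean_pos i' l
  mean_lt_one := by
    intro i' l
    by_cases hi : i' = i
    · subst hi
      by_cases hl : l = k
      · subst hl
        simpa using hq1
      · simpa [hl] using ν.mean_lt_one i' l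
    · simpa [hi] using ν.mean_lt_one i' l
  mean_injective := by
    intro i'
    by_cases hi : i' = i
    · subst hi
      rw [Function.update_self]
      intro l₁ l₂ h
      by_cases h1 : l₁ = k <;> by_cases h2 : l₂ = k
      · rw [h1, h2]
      · subst h1
        rw [Function.update_self, Function.update_of_ne h2] at h
        exact absurd h (hq l₂).ne'
      · subst h2
        rw [Function.update_self, Function.update_of_ne h1] at h
        exact absurd h (hq l₁).ne
      · rw [Function.update_of_ne h1, Function.update_of_ne h2] at h
        exact ν.mean_injective _ h
    · rw [Function.update_of_ne hi]
      exact ν.mean_injective i'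

/-- This perturbation keeps the means of an agent distinct, and vanishes at the last arm so that the
gap `d i` can be attained exactly. -/
theorem relativeExcess_nonneg (l : Fin K) : 0 ≤ ((K : ℝ) - 1 - l) / (2 * K) := by
  have h : ((l : ℕ) : ℝ) + 1 ≤ K := by exact_mod_cast l.2
  exact div_nonneg (by linarith) (by positivity)

theorem relativeExcess_le (l : Fin K) : ((K : ℝ) - 1 - l) / (2 * K) ≤ 1 / 2 := by
  have hK : (0 : ℝ) < K := by exact_mod_cast l.pos
  rw [div_le_iff₀ (by positivity)]
  have : (0 : ℝ) ≤ (l : ℕ) := by positivity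
  linarith

/-- The instance in which the `i`-th agent likes the `i`-th arm best, and its gaps to all other
arms are between `d i` and `3 / 2 * d i`, the last arm having the smallest gap. -/
noncomputable def diagonalInstance (hNK : N ≤ K) (d : Fin N → ℝ) (hd0 : ∀ i, 0 < d i)
    (hd1 : ∀ i, d i ≤ 1 / 4) : BernoulliInstance N K where
  mean i l := if l = Fin.castLE hNK i then 1 / 2 else
    1 / 2 - d i * (1 + ((K : ℝ) - 1 - l) / (2 * K))
  agents_le_arms := hNK
  -- Gaps are at most `3/2 * 1/4`, so all means are at least 1/8.
  mean_pos := by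
    intro i l
    have h0 := relativeExcess_nonneg l
    have h1 := relativeExcess_le l
    have h2 := hd0 i
    have h3 := hd1 i
    split_ifs
    · norm_num
    · nlinarith
  mean_lt_one := by
    intro i l
    have h0 := mul_nonneg (hd0 i).le (add_nonneg zero_le_one (relativeExcess_nonneg l))
    split_ifs
    · norm_num
    · linarith
  mean_injective := by
    intro i l₁ l₂ h
    have hlt : ∀ l : Fin K, 1 / 2 - d i * (1 + ((K : ℝ) - 1 - l) / (2 * K)) < 1 / 2 := fun l => by
      have h0 := mul_pos (hd0 i) (add_pos_of_pos_of_nonneg one_pos (relativeExcess_nonneg l))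
      linarith
    by_cases h1 : l₁ = Fin.castLE hNK i <;> by_cases h2 : l₂ = Fin.castLE hNK i
    · rw [h1, h2]
    · simp only [h1, h2, if_true, if_false] at h
      exact absurd h (hlt l₂).ne'
    · simp only [h1, h2, if_true, if_false] at h
      exact absurd h (hlt l₁).ne
    · simp only [h1, h2, if_false] at h
      have hK : (0 : ℝ) < K := by exact_mod_cast l₁.pos
      have h3 := mul_left_cancel₀ (hd0 i).ne' (sub_right_injective h)
      have h4 := (div_left_inj' (by positivity : (2 * (K : ℝ)) ≠ 0)).1 (add_left_cancel h3)
      have h5 : ((l₁ : ℕ) : ℝ) = ((l₂ : ℕ) : ℝ) := by linarith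
      exact Fin.ext (by exact_mod_cast h5)

section diagonalInstance

variable {hNK : N ≤ K} {d : Fin N → ℝ} {hd0 : ∀ i, 0 < d i} {hd1 : ∀ i, d i ≤ 1 / 4}

theorem diagonalInstance_mean_self (i : Fin N) :
    (diagonalInstance hNK d hd0 hd1).mean i (Fin.castLE hNK i) = 1 / 2 := by
  simp [diagonalInstance]

theorem diagonalInstance_mean_of_ne {i : Fin N} {l : Fin K} (hl : l ≠ Fin.castLE hNK i) :
    (diagonalInstance hNK d hd0 hd1).mean i l =
      1 / 2 - d i * (1 + ((K : ℝ) - 1 - l) / (2 * K)) := by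
  simp [diagonalInstance, hl]

theorem diagonalInstance_mean_add_le {i : Fin N} {l : Fin K} (hl : l ≠ Fin.castLE hNK i) :
    (diagonalInstance hNK d hd0 hd1).mean i l + d i ≤ 1 / 2 := by
  rw [diagonalInstance_mean_of_ne hl]
  nlinarith [mul_nonneg (hd0 i).le (relativeExcess_nonneg l)]

theorem diagonalInstance_le_mean (i : Fin N) (l : Fin K) :
    1 / 2 - 3 / 2 * d i ≤ (diagonalInstance hNK d hd0 hd1).mean i l := by
  have h := hd0 i
  by_cases hl : l = Fin.castLE hNK i
  · rw [hl, diagonalInstance_mean_self]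
    linarith
  · rw [diagonalInstance_mean_of_ne hl]
    nlinarith [mul_le_mul_of_nonneg_left (relativeExcess_le l) h.le]

theorem diagonalInstance_mean_le (i : Fin N) (l : Fin K) :
    (diagonalInstance hNK d hd0 hd1).mean i l ≤ 1 / 2 := by
  by_cases hl : l = Fin.castLE hNK i
  · rw [hl, diagonalInstance_mean_self]
  · linarith [diagonalInstance_mean_add_le (hd0 := hd0) (hd1 := hd1) hl, hd0 i]

theorem diagonalInstance_stableArm (i : Fin N) :
    (diagonalInstance hNK d hd0 hd1).stableArm i = Fin.castLE hNK i := by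
  refine BernoulliInstance.stableArm_eq_of_best _ (Fin.castLE hNK) i
    (fun i₁ i₂ h _ he => h.ne (Fin.castLE_injective hNK he)) fun i' _ l hl => ?_
  rw [diagonalInstance_mean_self]
  linarith [diagonalInstance_mean_add_le (hd0 := hd0) (hd1 := hd1) hl, hd0 i']

theorem diagonalInstance_isOSB : (diagonalInstance hNK d hd0 hd1).IsOSB := by
  intro i l hl
  rw [diagonalInstance_stableArm] at hl ⊢
  rw [diagonalInstance_mean_self]
  linarith [diagonalInstance_mean_add_le (hd0 := hd0) (hd1 := hd1) hl, hd0 i]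

/-- The top agent attains Δ at the last arm, which is not its partner because `2 ≤ K`. -/
theorem diagonalInstance_isMinGap (hK : 2 ≤ K) {Δ : ℝ} (hΔ : ∀ i, Δ ≤ d i) (i₀ : Fin N)
    (hi₀ : (i₀ : ℕ) = 0) (hdi₀ : d i₀ = Δ) : (diagonalInstance hNK d hd0 hd1).IsMinGap Δ := by
  constructor
  · have hlast : (⟨K - 1, by omega⟩ : Fin K) ≠ Fin.castLE hNK i₀ := by
      intro h
      have := congrArg Fin.val h
      simp only [Fin.val_castLE] at this
      omega
    refine ⟨i₀, ⟨K - 1, by omega⟩, ?_, ?_⟩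
    · intro i hi
      rw [show i = i₀ from le_antisymm hi (Fin.le_def.2 (by omega)), diagonalInstance_stableArm]
      exact hlast.symm
    · rw [BernoulliInstance.gap, diagonalInstance_stableArm, diagonalInstance_mean_self,
        diagonalInstance_mean_of_ne hlast, hdi₀]
      have : ((K - 1 : ℕ) : ℝ) = K - 1 := by
        rw [Nat.cast_sub (by omega)]; simp
      simp [this]
  · rintro δ ⟨i, l, hl, rfl⟩
    have h := hl i le_rfl
    rw [diagonalInstance_stableArm] at h
    rw [BernoulliInstance.gap, diagonalInstance_stableArm, diagonalInstance_mean_self]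
    linarith [diagonalInstance_mean_add_le (hd0 := hd0) (hd1 := hd1) h.symm, hΔ i]

/-- On the diagonal instance, a uniformly consistent policy matches each agent to each arm that is
not the stable partner of a higher ranked agent at least of the order `log T / (d i) ^ 2` times. -/
theorem eventually_log_le_matchCount {π : Policy N K} (hπ : UniformlyConsistent π) (i : Fin N)
    (k : Fin K) (hk : (i : ℕ) < k) :
    ∀ᶠ T : ℕ in Filter.atTop, Real.log T / (40 * d i ^ 2) ≤
      expectation (diagonalInstance hNK d hd0 hd1) π T (matchCount i k) := by
  set ν := diagonalInstance hNK d hd0 hd1 with hν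
  have hd := hd0 i
  have hd' := hd1 i
  have hki : k ≠ Fin.castLE hNK i := by
    rintro rfl
    simp at hk
  have hq : ∀ l, ν.mean i l < 1 / 2 + d i / 2 := fun l => by
    linarith [diagonalInstance_mean_le (hNK := hNK) (hd0 := hd0) (hd1 := hd1) i l]
  -- Both instances now have a best arm ahead by at least `d i / 2`, while the mean moves by at most
  -- `2 * d i`.
  let ν' := ν.raise i k (1 / 2 + d i / 2) hq (by linarith)
  have hmean : ν'.mean i k = 1 / 2 + d i / 2 := by
    simp [ν', BernoulliInstance.raise]
  have hne : ∀ i' k', ¬(i' = i ∧ k' = k) → ν'.mean i' k' = ν.mean i' k' := by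
    intro i' k' h
    by_cases hi : i' = i
    · subst hi
      have : k' ≠ k := fun h' => h ⟨rfl, h'⟩
      simp [ν', BernoulliInstance.raise, this]
    · simp [ν', BernoulliInstance.raise, hi]
  have hgap' : ∀ l, l ≠ k → ν'.mean i l + d i / 2 ≤ ν'.mean i k := by
    intro l hl
    rw [hne i l (fun h => hl h.2), hmean]
    linarith [diagonalInstance_mean_le (hNK := hNK) (hd0 := hd0) (hd1 := hd1) i l]
  have hstable' : ν'.stableArm i = k := by
    -- Favourites need only be distinct up to rank `i`: a lower ranked agent may also like `k` best.
    have h := ν'.stableArm_eq_of_best (Function.update (Fin.castLE hNK) i k) i ?_ ?_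
    · rw [h, Function.update_self]
    · intro i₁ i₂ h12 h2
      rw [Function.update_of_ne (h12.trans_le h2).ne]
      by_cases hi : i₂ = i
      · subst hi
        rw [Function.update_self]
        intro he
        have h3 := congrArg Fin.val he
        have h4 : (i₁ : ℕ) < i₂ := h12
        simp only [Fin.val_castLE] at h3
        omega
      · rw [Function.update_of_ne hi]
        exact fun he => h12.ne (Fin.castLE_injective hNK he)
    · intro i' hi' l hl
      by_cases hi : i' = i
      · subst hi
        rw [Function.update_self] at hl ⊢
        linarith [hgap' l hl]
      · rw [Function.update_of_ne hi] at hl ⊢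
        rw [hne _ _ (fun h => hi h.1), hne _ _ (fun h => hi h.1), diagonalInstance_mean_self]
        linarith [diagonalInstance_mean_add_le (hd0 := hd0) (hd1 := hd1) hl, hd0 i']
  have hmain := hπ.eventually_log_le (ν := ν) (ν' := ν') (i := i) (k := k) hne (half_pos hd)
    (by rw [diagonalInstance_stableArm]; exact hki)
    (by rw [diagonalInstance_stableArm, diagonalInstance_mean_self]; linarith)
    (by
      rw [diagonalInstance_stableArm, diagonalInstance_mean_self]
      intro l hl
      linarith [diagonalInstance_mean_add_le (hd0 := hd0) (hd1 := hd1) hl])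
    hstable' (by rw [hmean]; linarith) hgap'
  filter_upwards [hmain] with T hT
  have hcount : 0 ≤ expectation ν π T (matchCount i k) := by
    have := expectation_mono ν π T (matchCount_nonneg i k (T := T))
    rwa [expectation_const] at this
  -- The 20 is `2 ^ 2` divided by 1/5, a lower bound for the variance at the raised mean.
  have hkl : (ν.mean i k - ν'.mean i k) ^ 2 / (ν'.mean i k * (1 - ν'.mean i k)) ≤
      20 * d i ^ 2 := by
    rw [hmean]
    have h1 := diagonalInstance_le_mean (hNK := hNK) (hd0 := hd0) (hd1 := hd1) i k
    have h2 := diagonalInstance_mean_le (hNK := hNK) (hd0 := hd0) (hd1 := hd1) i k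
    rw [← hν] at h1 h2
    have h3 : (ν.mean i k - (1 / 2 + d i / 2)) ^ 2 ≤ (2 * d i) ^ 2 :=
      sq_le_sq' (by linarith) (by linarith)
    have h4 : (1 : ℝ) / 5 ≤ (1 / 2 + d i / 2) * (1 - (1 / 2 + d i / 2)) := by nlinarith
    rw [div_le_iff₀ (by linarith)]
    nlinarith [mul_le_mul_of_nonneg_left h4 (by positivity : 0 ≤ 20 * d i ^ 2)]
  have hfin := hT.trans (mul_le_mul_of_nonneg_right hkl hcount)
  rw [div_le_iff₀ (by positivity)]
  linarith

end diagonalInstance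

/-! ### Adding up match counts, and the two regimes of the bound -/

/-- At most one of the agents `i < j` is matched to the arm `k`, and then `j` is not. -/
theorem sum_matchedTo_le (j : Fin N) (k : Fin K) (a : Fin N → Fin K) :
    ∑ i ∈ Finset.Iio j, matchedTo i k a ≤ 1 - matchedTo j k a := by
  have hunique : ∀ i₁ i₂ : Fin N, Matched a i₁ ∧ a i₁ = k → Matched a i₂ ∧ a i₂ = k →
      i₁ = i₂ := by
    rintro i₁ i₂ ⟨m1, e1⟩ ⟨m2, e2⟩
    rcases lt_trichotomy i₁ i₂ with h | h | h
    · exact absurd (e1.trans e2.symm) (m2 i₁ h)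
    · exact h
    · exact absurd (e2.trans e1.symm) (m1 i₂ h)
  by_cases hex : ∃ i₀, Matched a i₀ ∧ a i₀ = k
  · obtain ⟨i₀, h0⟩ := hex
    have hform : ∀ i, matchedTo i k a = if i = i₀ then 1 else 0 := by
      intro i
      by_cases hi : i = i₀
      · subst hi
        simp [matchedTo, h0]
      · have : ¬(Matched a i ∧ a i = k) := fun h => hi (hunique i i₀ h h0)
        simp [matchedTo, this, hi]
    simp_rw [hform]
    rw [Finset.sum_ite_eq']
    by_cases hj : i₀ < j
    · simp [hj, hj.ne']
    · simp only [Finset.mem_Iio, hj, if_false]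
      split_ifs <;> norm_num
  · have hform : ∀ i, matchedTo i k a = 0 := fun i => by
      have : ¬(Matched a i ∧ a i = k) := fun h => hex ⟨i, h⟩
      simp [matchedTo, this]
    simp [hform]

/-- Agent `j` is matched to at most one arm. -/
theorem sum_arms_matchedTo_le (j : Fin N) (k : Fin K) (s : Finset (Fin K)) (hk : k ∉ s)
    (a : Fin N → Fin K) : ∑ l ∈ s, matchedTo j l a ≤ 1 - matchedTo j k a := by
  by_cases hm : Matched a j
  · simp only [matchedTo, hm, true_and]
    rw [Finset.sum_ite_eq]
    by_cases hs : a j ∈ s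
    · have : a j ≠ k := fun h => hk (h ▸ hs)
      simp [hs, this]
    · simp only [hs, if_false]
      split_ifs <;> norm_num
  · simp [matchedTo, hm]

theorem expectation_sum_matchCount {ι : Type*} (s : Finset ι) (f : ι → Fin N) (l : ι → Fin K)
    (ν : BernoulliInstance N K) (π : Policy N K) (T : ℕ) :
    expectation ν π T (fun h => ∑ t : Fin T, ∑ x ∈ s, matchedTo (f x) (l x) (h t).1) =
      ∑ x ∈ s, expectation ν π T (matchCount (f x) (l x)) := by
  rw [← expectation_sum]
  congr 1
  funext h
  exact Finset.sum_comm

end SerialDictatorship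

open SerialDictatorship in
theorem corollary2 :
    ∃ c : ℝ, 0 < c ∧
      ∀ (N K : ℕ), 2 ≤ K → N ≤ K → ∀ (j : Fin N) (Δ : ℝ), 0 < Δ → Δ ≤ 1 / 4 →
        ∃ ν : SerialDictatorship.BernoulliInstance N K, ν.IsOSB ∧ ν.IsMinGap Δ ∧
          ∀ π : SerialDictatorship.Policy N K, SerialDictatorship.UniformlyConsistent π →
            ∀ᶠ T : ℕ in Filter.atTop,
              c * max ((j : ℕ) * Real.log T / Δ ^ 2) (K * Real.log T / Δ) ≤
                SerialDictatorship.regret ν π j T := by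
  refine ⟨1 / 160, by norm_num, fun N K hK hNK j Δ hΔ hΔ4 => ?_⟩
  -- This condition decides which term of the maximum dominates. As indices start at 0, `(j : ℕ)` is
  -- the number of higher ranked agents.
  by_cases hcase : (K : ℝ) * Δ ≤ (j : ℕ)
  · have hj0 : 0 < (j : ℕ) := by
      have : (0 : ℝ) < (j : ℕ) := lt_of_lt_of_le (by positivity) hcase
      exact_mod_cast this
    -- Gap 1/4 for `j` makes every round in which arm `j` is taken cost a constant; `j` is not the
    -- top agent, which keeps the minimum gap at Δ.
    let d : Fin N → ℝ := Function.update (fun _ => Δ) j (1 / 4)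
    have hdj : d j = 1 / 4 := Function.update_self ..
    have hdne : ∀ i, i ≠ j → d i = Δ := fun i hi => Function.update_of_ne hi ..
    have hdmem : ∀ i, Δ ≤ d i ∧ d i ≤ 1 / 4 := fun i => by
      by_cases hi : i = j
      · rw [hi, hdj]; exact ⟨hΔ4, le_rfl⟩
      · rw [hdne i hi]; exact ⟨le_rfl, hΔ4⟩
    have hd0 : ∀ i, 0 < d i := fun i => hΔ.trans_le (hdmem i).1
    refine ⟨diagonalInstance hNK d hd0 fun i => (hdmem i).2, diagonalInstance_isOSB,
      diagonalInstance_isMinGap hK (fun i => (hdmem i).1) ⟨0, j.pos⟩ rfl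
        (hdne _ fun h => hj0.ne (congrArg Fin.val h)), fun π hπ => ?_⟩
    have hev : ∀ᶠ T : ℕ in Filter.atTop, ∀ i ∈ Finset.Iio j,
        Real.log T / (40 * d i ^ 2) ≤ expectation (diagonalInstance hNK d hd0
          fun i => (hdmem i).2) π T (matchCount i (Fin.castLE hNK j)) := by
      rw [Filter.eventually_all_finset]
      intro i hi
      exact eventually_log_le_matchCount hπ i _ (by simpa using hi)
    filter_upwards [hev] with T hT
    have hlog : 0 ≤ Real.log T := Real.log_natCast_nonneg T
    have hreg := le_regret_of_count
      (ν := diagonalInstance hNK d hd0 fun i => (hdmem i).2) (j := j) (g := 1 / 4) (by norm_num)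
      (by rw [diagonalInstance_stableArm, diagonalInstance_mean_self]; norm_num)
      (by
        rw [diagonalInstance_stableArm, diagonalInstance_mean_self]
        intro l hl
        have := diagonalInstance_mean_add_le (hd0 := hd0) (hd1 := fun i => (hdmem i).2) hl
        linarith)
      π T (fun a => ∑ i ∈ Finset.Iio j, matchedTo i (Fin.castLE hNK j) a)
      (fun a => by
        rw [diagonalInstance_stableArm]
        exact sum_matchedTo_le j _ a)
    rw [expectation_sum_matchCount] at hreg
    have hsum := Finset.sum_le_sum hT
    rw [Finset.sum_congr rfl (fun i hi => by
      rw [hdne i (Finset.mem_Iio.1 hi).ne] :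
        ∀ i ∈ Finset.Iio j,
          Real.log T / (40 * d i ^ 2) = Real.log T / (40 * Δ ^ 2)), Finset.sum_const,
      Fin.card_Iio, nsmul_eq_mul] at hsum
    have hmax : max ((j : ℕ) * Real.log T / Δ ^ 2) (K * Real.log T / Δ) =
        (j : ℕ) * Real.log T / Δ ^ 2 := by
      refine max_eq_left ?_
      rw [div_le_div_iff₀ hΔ (by positivity)]
      nlinarith [mul_le_mul_of_nonneg_right hcase (mul_nonneg hlog hΔ.le)]
    rw [hmax]
    have heq : (1 : ℝ) / 160 * ((j : ℕ) * Real.log T / Δ ^ 2) =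
        1 / 4 * ((j : ℕ) * (Real.log T / (40 * Δ ^ 2))) := by
      field_simp
      ring
    rw [heq]
    exact (mul_le_mul_of_nonneg_left hsum (by norm_num)).trans hreg
  · push Not at hcase
    refine ⟨diagonalInstance hNK (fun _ => Δ) (fun _ => hΔ) (fun _ => hΔ4), diagonalInstance_isOSB,
      diagonalInstance_isMinGap hK (fun _ => le_rfl) ⟨0, j.pos⟩ rfl rfl, fun π hπ => ?_⟩
    have hev : ∀ᶠ T : ℕ in Filter.atTop, ∀ l ∈ Finset.Ioi (Fin.castLE hNK j),
        Real.log T / (40 * Δ ^ 2) ≤ expectation (diagonalInstance hNK (fun _ => Δ)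
          (fun _ => hΔ) (fun _ => hΔ4)) π T (matchCount j l) := by
      rw [Filter.eventually_all_finset]
      intro l hl
      exact eventually_log_le_matchCount (d := fun _ => Δ) hπ j l
        (Fin.lt_def.1 (Finset.mem_Ioi.1 hl))
    filter_upwards [hev] with T hT
    have hlog : 0 ≤ Real.log T := Real.log_natCast_nonneg T
    have hreg := le_regret_of_count
      (ν := diagonalInstance hNK (fun _ => Δ) (fun _ => hΔ) (fun _ => hΔ4)) (j := j) (g := Δ) hΔ.le
      (by rw [diagonalInstance_stableArm, diagonalInstance_mean_self]; linarith)
      (by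
        rw [diagonalInstance_stableArm, diagonalInstance_mean_self]
        intro l hl
        exact diagonalInstance_mean_add_le (d := fun _ => Δ) hl)
      π T (fun a => ∑ l ∈ Finset.Ioi (Fin.castLE hNK j), matchedTo j l a)
      (fun a => by
        rw [diagonalInstance_stableArm]
        exact sum_arms_matchedTo_le j _ _ (by simp) a)
    rw [expectation_sum_matchCount] at hreg
    have hsum := Finset.sum_le_sum hT
    rw [Finset.sum_const, Fin.card_Ioi, nsmul_eq_mul, Fin.val_castLE] at hsum
    -- Here `j < K * Δ ≤ K / 4`, and `3 * K / 4 - 1 ≥ K / 4` because `2 ≤ K`.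
    have hcard : (K : ℝ) / 4 ≤ ((K - 1 - (j : ℕ) : ℕ) : ℝ) := by
      have h1 : (j : ℕ) + 1 ≤ K := j.2.trans_le hNK
      have h2 : (2 : ℝ) ≤ K := by exact_mod_cast hK
      rw [Nat.sub_sub, Nat.cast_sub (by omega)]
      push_cast
      nlinarith
    have hmax : max ((j : ℕ) * Real.log T / Δ ^ 2) (K * Real.log T / Δ) =
        K * Real.log T / Δ := by
      refine max_eq_right ?_
      rw [div_le_div_iff₀ (by positivity) hΔ]
      nlinarith [mul_le_mul_of_nonneg_right hcase.le (mul_nonneg hlog hΔ.le)]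
    rw [hmax]
    have heq : (1 : ℝ) / 160 * (K * Real.log T / Δ) =
        Δ * (K / 4 * (Real.log T / (40 * Δ ^ 2))) := by
      field_simp
      ring
    rw [heq]
    refine le_trans (mul_le_mul_of_nonneg_left ?_ hΔ.le) hreg
    exact (mul_le_mul_of_nonneg_right hcard (by positivity)).trans hsum
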